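/- **Theorem 2 (Global Asymptotic Stability).** Let $n\in\mathbb N$, $A,B\in\mathbb R^{n\times n}$, $w\in\mathbb R^n$ and $f,h:\mathbb R^n\to\mathbb R^n$. Assume: 1. $f(u)=[f_1(u_1),\dots,f_n(u_n)]^\top$, where each $f_i:\mathbb R\to\mathbb R$ satisfies $f_i(0)=0$ and $0\le \frac{f_i(y)-f_i(x)}{y-x}\le 1$ for all $x\ne y$ in $\mathbb R$; and $f(u)+h(u)=u$ for all $u\in\mathbb R^n$, so that $h(u)=[h_1(u_1),\dots,h_n(u_n)]^\top$ with $h_i(t)=t-f_i(t)$. 2. $A$ is diagonal and positive definite, with diagonal elements $a_1,\dots,a_n$; $B$ is an M-matrix, that is, all its off-diagonal elements are non-positive and all its (complex) eigenvalues have positive real part. 3. $p_i>0$, $r_i>0$, $s_i>0$, $a_ip_i>r_i$ and $p_is_i<1$ for $i=1,\dots,n$. Consider the closed loop with state $(x,z)\in\mathbb R^n\times\mathbb R^n$ given by $$\dot x=-Ax+Bf(u)+w,\qquad \dot z_i=x_i+s_ih_i(u_i),\qquad u_i=-p_ix_i-r_iz_i\qquad(i=1,\dots,n).$$ Then this closed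 loop has exactly one equilibrium $(x^0,z^0)$, and this equilibrium is globally asymptotically stable: for every initial state there is a unique solution, defined for all $t\ge 0$; the equilibrium is stable in the sense of Lyapunov (for every $\varepsilon>0$ there is $\delta>0$ such that every solution starting at distance less than $\delta$ from $(x^0,z^0)$ stays at distance less than $\varepsilon$ from it for all $t\ge0$); and every solution converges to $(x^0,z^0)$ as $t\to\infty$. -/

import Mathlib

open Filter Topology

section Dynamics

variable {E : Type*} [NormedAddCommGroup E] [NormedSpace ℝ E]

/-- `ξ` solves the autonomous equation `ξ' = F ξ` on the time set `I` (an interval with left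
endpoint `0` below; at `t = 0` the derivative is then the right derivative). -/
def IsSolutionOn (F : E → E) (I : Set ℝ) (ξ : ℝ → E) : Prop :=
  ∀ t ∈ I, HasDerivWithinAt ξ (F (ξ t)) I t

/-- `e` is an equilibrium of `ξ' = F ξ`. -/
def IsEquilibrium (F : E → E) (e : E) : Prop := F e = 0

/-- Every initial state has a solution for all `t ≥ 0`, and every solution on some `[0, T)` with
the same initial state coincides with it there. -/
def ForwardWellPosed (F : E → E) : Prop :=
  ∀ ξ₀ : E, ∃ ξ : ℝ → E, IsSolutionOn F (Set.Ici 0) ξ ∧ ξ 0 = ξ₀ ∧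
    ∀ T : ℝ, 0 < T → ∀ η : ℝ → E, IsSolutionOn F (Set.Ico 0 T) η → η 0 = ξ₀ →
      Set.EqOn η ξ (Set.Ico 0 T)

/-- Lyapunov stability of `e`. -/
def IsLyapunovStable (F : E → E) (e : E) : Prop :=
  ∀ ε : ℝ, 0 < ε → ∃ δ : ℝ, 0 < δ ∧ ∀ ξ : ℝ → E, IsSolutionOn F (Set.Ici 0) ξ →
    ‖ξ 0 - e‖ < δ → ∀ t : ℝ, 0 ≤ t → ‖ξ t - e‖ < ε

/-- Every solution on `[0, ∞)` converges to `e`. -/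
def IsGloballyAttractive (F : E → E) (e : E) : Prop :=
  ∀ ξ : ℝ → E, IsSolutionOn F (Set.Ici 0) ξ → Tendsto ξ atTop (𝓝 e)

/-- `e` is a globally asymptotically stable equilibrium of `ξ' = F ξ`: the equation has a unique
solution for all `t ≥ 0` from every initial state, `e` is Lyapunov stable, and all solutions
converge to `e`. -/
structure IsGloballyAsymptoticallyStable (F : E → E) (e : E) : Prop where
  equilibrium : IsEquilibrium F e
  wellPosed : ForwardWellPosed F
  stable : IsLyapunovStable F e
  attractive : IsGloballyAttractive F e

end Dynamics

/-- `f` acts componentwise, `f(u) = (f₁(u₁), …, fₙ(uₙ))`, with `fᵢ(0) = 0` and every `fᵢ`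
incrementally sector-bounded in the sector `[0, 1]`. -/
def IsIncrementallySectorBounded {n : ℕ} (f : (Fin n → ℝ) → (Fin n → ℝ)) : Prop :=
  ∃ φ : Fin n → ℝ → ℝ, (∀ u i, f u i = φ i (u i)) ∧ ∀ i, φ i 0 = 0 ∧
    ∀ x y : ℝ, x ≠ y → 0 ≤ (φ i y - φ i x) / (y - x) ∧ (φ i y - φ i x) / (y - x) ≤ 1

/-- All (complex) eigenvalues of the real matrix `B` have positive real part. -/
def IsPositiveStable {n : ℕ} (B : Matrix (Fin n) (Fin n) ℝ) : Prop :=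
  ∀ μ : ℂ, Module.End.HasEigenvalue (Matrix.toLin' (B.map Complex.ofReal)) μ → 0 < μ.re

/-- M-matrix: positive stable with non-positive off-diagonal elements. -/
def IsMMatrix {n : ℕ} (B : Matrix (Fin n) (Fin n) ℝ) : Prop :=
  IsPositiveStable B ∧ ∀ i j, i ≠ j → B i j ≤ 0

/-- The controller output `uᵢ = -pᵢ xᵢ - rᵢ zᵢ`. -/
def controllerOutput {n : ℕ} (p r : Fin n → ℝ) (x z : Fin n → ℝ) : Fin n → ℝ :=
  fun i => -(p i) * x i - r i * z i

/-- The closed-loop vector field in the state `(x, z)`: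
`x' = -A x + B f(u) + w`, `zᵢ' = xᵢ + sᵢ hᵢ(u)`, where `uᵢ = -pᵢ xᵢ - rᵢ zᵢ`. -/
def closedLoop {n : ℕ} (A B : Matrix (Fin n) (Fin n) ℝ)
    (f h : (Fin n → ℝ) → (Fin n → ℝ)) (p r s w : Fin n → ℝ) :
    (Fin n → ℝ) × (Fin n → ℝ) → (Fin n → ℝ) × (Fin n → ℝ) :=
  fun ξ =>
    (-(A.mulVec ξ.1) + B.mulVec (f (controllerOutput p r ξ.1 ξ.2)) + w,
      fun i => ξ.1 i + s i * h (controllerOutput p r ξ.1 ξ.2) i)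

/-! ### Flows of vector fields whose Euler map is a contraction -/

section Contraction

variable {E : Type*} [NormedAddCommGroup E] [NormedSpace ℝ E]

/-! Put c = a p - r > 0. In the coordinates (u, z) the system reads u' = -(c/p)(u + r z) - p(B f +
w) - r s h and z' = -(r/p) z - f/p - (1/p - s) h. For two states, the increments of f and h have
equal signs, so |Δu| = |Δf| + |Δh|, and |Δf|, |Δh|, |Δz| can be balanced separately. The M-matrix
property gives d > 0 with all column sums of diag(d) B equal to 1
(`IsMMatrix.exists_pos_vecMul_eq_one`). With weights α = d/p on u and αk on z, the ℓ¹ norm grows at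
rates at most -1 + α(k - c)/p on |Δf|, -α(r s + c s - (k - c)(1/p - s)) on |Δh| and -α r(k - c)/p on
|Δz|. All are negative when k exceeds c slightly. Hence a small Euler step is a strict contraction
(`sum_weighted_abs_euler_le`). Its fixed point is the equilibrium, and the contraction also yields
existence, uniqueness and exponential convergence of solutions. -/

theorem IsSolutionOn.mono {F : E → E} {I J : Set ℝ} {ξ : ℝ → E} (h : IsSolutionOn F I ξ)
    (hJ : J ⊆ I) : IsSolutionOn F J ξ := fun t ht => (h t (hJ ht)).mono hJ

/-- If the Euler map `x ↦ x + τ F x` is a `q`-contraction, the distance of two solutions of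
`ξ' = F ξ` decays exponentially. -/
theorem IsSolutionOn.norm_sub_le_exp {F : E → E} {τ q : ℝ} (hτ : 0 < τ)
    (hF : ∀ x y, ‖(x + τ • F x) - (y + τ • F y)‖ ≤ q * ‖x - y‖) {T : ℝ} {ξ η : ℝ → E}
    (hξ : IsSolutionOn F (Set.Ico 0 T) ξ) (hη : IsSolutionOn F (Set.Ico 0 T) η)
    {t : ℝ} (ht : t ∈ Set.Ico 0 T) :
    ‖ξ t - η t‖ ≤ ‖ξ 0 - η 0‖ * Real.exp (-((1 - q) / τ) * t) := by
  -- With G = id + τF the field is (G - id)/τ; the factor exp(s/τ) removes the -id part and leaves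
  -- growth rate q/τ for Grönwall.
  let ψ : ℝ → E := fun s => Real.exp (s / τ) • (ξ s - η s)
  let ψ' : ℝ → E := fun s => Real.exp (s / τ) • (F (ξ s) - F (η s)) +
    (Real.exp (s / τ) * (1 / τ)) • (ξ s - η s)
  have hsub : Set.Icc 0 t ⊆ Set.Ico 0 T := fun s hs => ⟨hs.1, hs.2.trans_lt ht.2⟩
  have hder : ∀ s ∈ Set.Ico 0 T, HasDerivWithinAt ψ (ψ' s) (Set.Ico 0 T) s := fun s hs =>
    (((hasDerivAt_id s).div_const τ).exp.hasDerivWithinAt).smul ((hξ s hs).sub (hη s hs))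
  have hcont : ContinuousOn ψ (Set.Icc 0 t) := fun s hs =>
    (hder s (hsub hs)).continuousWithinAt.mono hsub
  have hright : ∀ s ∈ Set.Ico 0 t, HasDerivWithinAt ψ (ψ' s) (Set.Ici s) s := by
    intro s hs
    refine (hder s (hsub ⟨hs.1, hs.2.le⟩)).mono_of_mem_nhdsWithin ?_
    exact mem_of_superset (Ico_mem_nhdsGE (hs.2.trans ht.2)) fun r hr => ⟨hs.1.trans hr.1, hr.2⟩
  have hbound : ∀ s ∈ Set.Ico 0 t, ‖ψ' s‖ ≤ q / τ * ‖ψ s‖ + 0 := by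
    intro s _
    have h1 : ψ' s = (Real.exp (s / τ) / τ) • ((ξ s + τ • F (ξ s)) - (η s + τ • F (η s))) := by
      simp only [ψ']
      match_scalars <;> field_simp
    rw [h1, norm_smul, norm_smul, Real.norm_of_nonneg (by positivity),
      Real.norm_of_nonneg (by positivity), add_zero]
    calc Real.exp (s / τ) / τ * ‖ξ s + τ • F (ξ s) - (η s + τ • F (η s))‖
        ≤ Real.exp (s / τ) / τ * (q * ‖ξ s - η s‖) := by gcongr; exact hF _ _
      _ = _ := by ring
  have hG := norm_le_gronwallBound_of_norm_deriv_right_le hcont hright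
    (δ := ‖ξ 0 - η 0‖) (by simp [ψ]) hbound t ⟨ht.1, le_rfl⟩
  rw [gronwallBound_ε0, sub_zero, norm_smul, Real.norm_of_nonneg (by positivity)] at hG
  have h2 : -((1 - q) / τ) * t = q / τ * t + -(t / τ) := by ring
  rw [h2, Real.exp_add, Real.exp_neg, ← mul_assoc, ← div_eq_mul_inv,
    le_div_iff₀ (Real.exp_pos _), mul_comm]
  exact hG

/-- The exponentially weighted average of a bounded function obeys the same bound. -/
theorem norm_exp_smul_integral_le {τ t M : ℝ} (hτ : 0 < τ) (ht : 0 ≤ t) {g : ℝ → E}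
    (hM : ∀ s, ‖g s‖ ≤ M) :
    ‖Real.exp (-(t / τ)) • ∫ s in (0 : ℝ)..t, (Real.exp (s / τ) / τ) • g s‖ ≤ M := by
  have hM0 : 0 ≤ M := (norm_nonneg _).trans (hM 0)
  have hint : ∫ s in (0 : ℝ)..t, Real.exp (s / τ) / τ * M = (Real.exp (t / τ) - 1) * M := by
    have hd : ∀ s ∈ Set.uIcc 0 t,
        HasDerivAt (fun s => Real.exp (s / τ) * M) (Real.exp (s / τ) / τ * M) s := by
      intro s _
      have := (((hasDerivAt_id s).div_const τ).exp).mul_const M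
      simpa [div_eq_mul_inv] using this
    rw [intervalIntegral.integral_eq_sub_of_hasDerivAt hd
      (Continuous.intervalIntegrable (by fun_prop) _ _)]
    simp [sub_mul]
  have hle : ‖∫ s in (0 : ℝ)..t, (Real.exp (s / τ) / τ) • g s‖ ≤ (Real.exp (t / τ) - 1) * M := by
    rw [← hint]
    refine intervalIntegral.norm_integral_le_of_norm_le ht (Eventually.of_forall fun s _ => ?_)
      (Continuous.intervalIntegrable (by fun_prop) _ _)
    rw [norm_smul, Real.norm_of_nonneg (by positivity)]
    gcongr
    exact hM s
  rw [norm_smul, Real.norm_of_nonneg (by positivity)]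
  calc Real.exp (-(t / τ)) * ‖∫ s in (0 : ℝ)..t, (Real.exp (s / τ) / τ) • g s‖
      ≤ Real.exp (-(t / τ)) * (Real.exp (t / τ) * M) := by
        gcongr
        nlinarith
    _ = M := by rw [← mul_assoc, ← Real.exp_add]; simp

open BoundedContinuousFunction in
/-- Global forward existence when the Euler map `x ↦ x + τ F x` is a contraction: the solution is
the fixed point of the variation-of-constants operator on bounded continuous functions. -/
theorem exists_isSolutionOn_of_euler_contraction [CompleteSpace E] {F : E → E} {τ q : ℝ}
    (hτ : 0 < τ) (hq : 0 ≤ q) (hq1 : q < 1)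
    (hF : ∀ x y, ‖(x + τ • F x) - (y + τ • F y)‖ ≤ q * ‖x - y‖) (ξ₀ : E) :
    ∃ ξ : ℝ → E, IsSolutionOn F (Set.Ici 0) ξ ∧ ξ 0 = ξ₀ := by
  let G : E → E := fun x => x + τ • F x
  have hGL : LipschitzWith ⟨q, hq⟩ G := LipschitzWith.of_dist_le_mul fun x y => by
    rw [dist_eq_norm, dist_eq_norm]; exact hF x y
  have hint : ∀ ξ : ℝ →ᵇ E, Continuous fun s : ℝ => (Real.exp (s / τ) / τ) • G (ξ s) := fun ξ =>
    (by fun_prop : Continuous fun s : ℝ => Real.exp (s / τ) / τ).smul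
      (hGL.continuous.comp ξ.continuous)
  let Ψ : (ℝ →ᵇ E) → ℝ → E := fun ξ t =>
    Real.exp (-(t / τ)) • (ξ₀ + ∫ s in (0 : ℝ)..t, (Real.exp (s / τ) / τ) • G (ξ s))
  have hΨc : ∀ ξ, Continuous (Ψ ξ) := by
    intro ξ
    have h1 : Continuous fun t : ℝ => ∫ s in (0 : ℝ)..t, (Real.exp (s / τ) / τ) • G (ξ s) :=
      intervalIntegral.continuous_primitive (fun a b => (hint ξ).intervalIntegrable a b) 0
    fun_prop
  have hΨb : ∀ ξ : ℝ →ᵇ E, ∀ t, 0 ≤ t → ‖Ψ ξ t‖ ≤ ‖ξ₀‖ + (‖G 0‖ + q * ‖ξ‖) := by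
    intro ξ t ht
    simp only [Ψ, smul_add]
    refine (norm_add_le _ _).trans (add_le_add ?_ (norm_exp_smul_integral_le hτ ht fun s => ?_))
    · rw [norm_smul, Real.norm_of_nonneg (by positivity)]
      refine mul_le_of_le_one_left (norm_nonneg _) (Real.exp_le_one_iff.2 ?_)
      have : 0 ≤ t / τ := by positivity
      linarith
    · have h1 : ‖G (ξ s) - G 0‖ ≤ q * ‖ξ s - 0‖ := hF _ _
      rw [sub_zero] at h1
      have h2 := norm_le_norm_add_norm_sub' (G (ξ s)) (G 0)
      have h3 := mul_le_mul_of_nonneg_left (ξ.norm_coe_le_norm s) hq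
      linarith
  -- The bound on `Ψ` holds only for t ≥ 0, so negative times are frozen at the value for 0.
  let Φ : (ℝ →ᵇ E) → (ℝ →ᵇ E) := fun ξ =>
    BoundedContinuousFunction.ofNormedAddCommGroup (fun t => Ψ ξ (max t 0))
      ((hΨc ξ).comp (by fun_prop)) _ fun t => hΨb ξ _ (le_max_right _ _)
  have hΦ : ContractingWith ⟨q, hq⟩ Φ := by
    refine ⟨by exact_mod_cast hq1, LipschitzWith.of_dist_le_mul fun ξ η => ?_⟩
    have hnn : 0 ≤ q * dist ξ η := by positivity
    refine (BoundedContinuousFunction.dist_le hnn).2 fun t => ?_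
    have h1 : Φ ξ t - Φ η t = Real.exp (-(max t 0 / τ)) •
        ∫ s in (0 : ℝ)..max t 0, (Real.exp (s / τ) / τ) • (G (ξ s) - G (η s)) := by
      simp only [Φ, Ψ, BoundedContinuousFunction.coe_ofNormedAddCommGroup, smul_sub]
      rw [intervalIntegral.integral_sub ((hint ξ).intervalIntegrable _ _)
        ((hint η).intervalIntegrable _ _)]
      module
    rw [dist_eq_norm, h1]
    refine norm_exp_smul_integral_le hτ (le_max_right _ _) fun s => (hF _ _).trans ?_
    gcongr
    rw [← dist_eq_norm]
    exact BoundedContinuousFunction.dist_coe_le_dist s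
  let ξ := ContractingWith.fixedPoint Φ hΦ
  have hfix : Φ ξ = ξ := hΦ.fixedPoint_isFixedPt
  have hξ : ∀ t, 0 ≤ t → ξ t = Ψ ξ t := by
    intro t ht
    have := congrArg (fun f : ℝ →ᵇ E => f t) hfix
    simp only [Φ, BoundedContinuousFunction.coe_ofNormedAddCommGroup, max_eq_left ht] at this
    exact this.symm
  -- `Ψ ξ` agrees with `ξ` for t ≥ 0 but is differentiable on both sides of 0, where the frozen `ξ`
  -- may have a corner.
  refine ⟨Ψ ξ, fun t ht => ?_, by simp [Ψ]⟩
  have hI : HasDerivAt (fun t : ℝ => ∫ s in (0 : ℝ)..t, (Real.exp (s / τ) / τ) • G (ξ s))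
      ((Real.exp (t / τ) / τ) • G (ξ t)) t :=
    (hint ξ).integral_hasStrictDerivAt 0 t |>.hasDerivAt
  have hE : HasDerivAt (fun t : ℝ => Real.exp (-(t / τ))) (Real.exp (-(t / τ)) * (-(1 / τ))) t :=
    ((hasDerivAt_id t).div_const τ).neg.exp
  have hD : HasDerivAt (Ψ ξ) _ t := hE.smul (hI.const_add ξ₀)
  refine (hD.congr_deriv ?_).hasDerivWithinAt
  have h2 : (Real.exp (-(t / τ)) * -(1 / τ)) •
      (ξ₀ + ∫ s in (0 : ℝ)..t, (Real.exp (s / τ) / τ) • G (ξ s)) = (-(1 / τ)) • ξ t := by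
    rw [hξ t ht, mul_comm, mul_smul]
  have h3 : Real.exp (-(t / τ)) * (Real.exp (t / τ) / τ) = 1 / τ := by
    rw [← mul_div_assoc, ← Real.exp_add]; simp
  rw [h2, smul_smul, h3, ← hξ t ht]
  simp only [G]
  match_scalars <;> field_simp
  ring

/-- If the Euler map `x ↦ x + τ F x` is a contraction for some `τ > 0`, then `ξ' = F ξ` has exactly
one equilibrium, and it is globally asymptotically stable. -/
theorem exists_isGloballyAsymptoticallyStable_of_euler_contraction [CompleteSpace E] {F : E → E}
    {τ q : ℝ} (hτ : 0 < τ) (hq : 0 ≤ q) (hq1 : q < 1)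
    (hF : ∀ x y, ‖(x + τ • F x) - (y + τ • F y)‖ ≤ q * ‖x - y‖) :
    ∃ e, (∀ e', IsEquilibrium F e' → e' = e) ∧ IsGloballyAsymptoticallyStable F e := by
  have hG : ContractingWith ⟨q, hq⟩ fun x => x + τ • F x :=
    ⟨by exact_mod_cast hq1, LipschitzWith.of_dist_le_mul fun x y => by
      rw [dist_eq_norm, dist_eq_norm]; exact hF x y⟩
  let e := ContractingWith.fixedPoint _ hG
  have he : F e = 0 := by
    have h1 : e + τ • F e = e := hG.fixedPoint_isFixedPt
    simpa [hτ.ne'] using h1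
  have hrate : 0 < (1 - q) / τ := div_pos (by linarith) hτ
  have hconst : IsSolutionOn F (Set.Ici 0) fun _ => e := fun t _ => by
    rw [he]; exact hasDerivWithinAt_const t _ e
  have hdecay : ∀ ξ : ℝ → E, IsSolutionOn F (Set.Ici 0) ξ → ∀ t, 0 ≤ t →
      ‖ξ t - e‖ ≤ ‖ξ 0 - e‖ * Real.exp (-((1 - q) / τ) * t) := fun ξ hξ t ht =>
    (hξ.mono Set.Ico_subset_Ici_self).norm_sub_le_exp hτ hF
      (hconst.mono Set.Ico_subset_Ici_self) (T := t + 1) ⟨ht, by linarith⟩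
  refine ⟨e, fun e' he' => ?_, he, fun ξ₀ => ?_, fun ε hε => ⟨ε, hε, fun ξ hξ h0 t ht => ?_⟩,
    fun ξ hξ => ?_⟩
  · have h1 : F e' = 0 := he'
    exact hG.fixedPoint_unique (by simp [Function.IsFixedPt, h1])
  · obtain ⟨ξ, hξ, hξ0⟩ := exists_isSolutionOn_of_euler_contraction hτ hq hq1 hF ξ₀
    refine ⟨ξ, hξ, hξ0, fun T _ η hη hη0 t ht => ?_⟩
    have := hη.norm_sub_le_exp hτ hF (hξ.mono Set.Ico_subset_Ici_self) ht
    rw [hη0, hξ0, sub_self, norm_zero, zero_mul] at this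
    exact sub_eq_zero.1 (norm_le_zero_iff.1 this)
  · refine ((hdecay ξ hξ t ht).trans ?_).trans_lt h0
    refine mul_le_of_le_one_right (norm_nonneg _) (Real.exp_le_one_iff.2 ?_)
    have : 0 ≤ (1 - q) / τ * t := by positivity
    linarith
  · rw [tendsto_iff_norm_sub_tendsto_zero]
    refine squeeze_zero' (Eventually.of_forall fun _ => norm_nonneg _)
      ((eventually_ge_atTop 0).mono (hdecay ξ hξ)) ?_
    have h1 : Tendsto (fun t => -((1 - q) / τ) * t) atTop atBot :=
      tendsto_id.const_mul_atTop_of_neg (by linarith)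
    simpa using (Real.tendsto_exp_atBot.comp h1).const_mul ‖ξ 0 - e‖

end Contraction

/-! ### Invariance under linear coordinates -/

section Transport

variable {E E' : Type*} [NormedAddCommGroup E] [NormedSpace ℝ E] [NormedAddCommGroup E']
  [NormedSpace ℝ E']

/-- A linear change of coordinates maps solutions to solutions of the conjugated equation. -/
theorem IsSolutionOn.conj {F : E → E} {I : Set ℝ} {ξ : ℝ → E} (h : IsSolutionOn F I ξ)
    (T : E ≃L[ℝ] E') : IsSolutionOn (fun y => T (F (T.symm y))) I (fun t => T (ξ t)) := by
  intro t ht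
  simp only [T.symm_apply_apply]
  exact (T : E →L[ℝ] E').hasFDerivAt.comp_hasDerivWithinAt t (h t ht)

/-- Global asymptotic stability does not depend on the choice of linear coordinates. -/
theorem IsGloballyAsymptoticallyStable.of_conj {F : E → E} (T : E ≃L[ℝ] E') {e : E'}
    (h : IsGloballyAsymptoticallyStable (fun y => T (F (T.symm y))) e) :
    IsGloballyAsymptoticallyStable F (T.symm e) := by
  refine ⟨?_, fun ξ₀ => ?_, fun ε hε => ?_, fun ξ hξ => ?_⟩
  · exact T.map_eq_zero_iff.1 h.equilibrium
  · obtain ⟨ξ, hξ, hξ0, huniq⟩ := h.wellPosed (T ξ₀)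
    refine ⟨fun t => T.symm (ξ t), ?_, by simp [hξ0], fun T' hT' η hη hη0 t ht => ?_⟩
    · simpa using hξ.conj T.symm
    · have := huniq T' hT' _ (hη.conj T) (by simp [hη0]) ht
      exact T.eq_symm_apply.2 this
  · have hsymm : Tendsto (fun y => T.symm y) (𝓝 e) (𝓝 (T.symm e)) := T.symm.continuous.continuousAt
    obtain ⟨ε', hε', hsub'⟩ := Metric.tendsto_nhds_nhds.1 hsymm ε hε
    obtain ⟨δ', hδ', hst⟩ := h.stable ε' hε'
    have hT : Tendsto (fun x => T x) (𝓝 (T.symm e)) (𝓝 (T (T.symm e))) :=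
      T.continuous.continuousAt
    obtain ⟨δ, hδ, hsub⟩ := Metric.tendsto_nhds_nhds.1 hT δ' hδ'
    refine ⟨δ, hδ, fun ξ hξ h0 t ht => ?_⟩
    have h1 := hsub (x := ξ 0) (by rwa [dist_eq_norm])
    rw [T.apply_symm_apply, dist_eq_norm] at h1
    have h2 := hsub' (x := T (ξ t)) (by rw [dist_eq_norm]; exact hst _ (hξ.conj T) h1 t ht)
    rwa [T.symm_apply_apply, dist_eq_norm] at h2
  · have := (T.symm.continuous.tendsto e).comp (h.attractive _ (hξ.conj T))
    simpa [Function.comp_def] using this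

end Transport

/-! ### Positive multipliers for M-matrices -/

/-- A real matrix with positive stable spectrum stays nonsingular under nonnegative shifts. -/
theorem IsPositiveStable.det_transpose_add_smul_one_ne_zero {n : ℕ}
    {B : Matrix (Fin n) (Fin n) ℝ} (hB : IsPositiveStable B) {t : ℝ} (ht : 0 ≤ t) :
    (B.transpose + t • (1 : Matrix (Fin n) (Fin n) ℝ)).det ≠ 0 := by
  intro h0
  have h1 : (B + t • (1 : Matrix (Fin n) (Fin n) ℝ)).det = 0 := by
    rw [← Matrix.det_transpose]
    simpa using h0
  obtain ⟨v, hv, hBv⟩ := Matrix.exists_mulVec_eq_zero_iff.2 h1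
  have hBv' : ∀ i, B.mulVec v i = -t * v i := by
    intro i
    have := congrFun hBv i
    simp only [Matrix.add_mulVec, Matrix.smul_mulVec, Matrix.one_mulVec, Pi.add_apply,
      Pi.smul_apply, smul_eq_mul, Pi.zero_apply] at this
    linarith
  have hev : Module.End.HasEigenvalue (Matrix.toLin' (B.map Complex.ofReal)) ((-t : ℝ) : ℂ) := by
    apply Module.End.hasEigenvalue_of_hasEigenvector (x := fun i => ((v i : ℝ) : ℂ))
    refine ⟨Module.End.mem_eigenspace_iff.2 ?_, ?_⟩
    · ext i
      have := congrArg Complex.ofReal (hBv' i)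
      simpa [Matrix.mulVec, dotProduct] using this
    · intro hz
      apply hv
      ext i
      have := congrFun hz i
      simpa using this
  have := hB _ hev
  simp only [Complex.ofReal_re] at this
  linarith

/-- An M-matrix has a positive left multiplier turning it into a matrix with unit column sums. -/
theorem IsMMatrix.exists_pos_vecMul_eq_one {n : ℕ} {B : Matrix (Fin n) (Fin n) ℝ}
    (hB : IsMMatrix B) : ∃ d : Fin n → ℝ, (∀ i, 0 < d i) ∧ ∀ j, ∑ i, d i * B i j = 1 := by
  obtain ⟨hstab, hoff⟩ := hB
  -- Homotopy in t ≥ 0: the solution `d t` of (Bᵀ + t I) d = 1 is continuous, is positive for one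
  -- large t, and cannot lose positivity on the connected half-line.
  let S : NNReal → Matrix (Fin n) (Fin n) ℝ := fun t => B.transpose + (t : ℝ) • 1
  have hS : Continuous S := by fun_prop
  have hdet : ∀ t, (S t).det ≠ 0 := fun t =>
    hstab.det_transpose_add_smul_one_ne_zero t.coe_nonneg
  let d : NNReal → Fin n → ℝ := fun t => ((S t).det)⁻¹ • ((S t).adjugate.mulVec 1)
  have hd : Continuous d :=
    (hS.matrix_det.inv₀ hdet).smul (hS.matrix_adjugate.matrix_mulVec continuous_const)
  have hSd : ∀ t, (S t).mulVec (d t) = 1 := by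
    intro t
    simp only [d, Matrix.mulVec_smul, Matrix.mulVec_mulVec, Matrix.mul_adjugate,
      Matrix.smul_mulVec, Matrix.one_mulVec, smul_smul, inv_mul_cancel₀ (hdet t), one_smul]
  have hrow : ∀ (t : NNReal) j, (∑ i, B i j * d t i) + t * d t j = 1 := by
    intro t j
    have := congrFun (hSd t) j
    simp only [S, Matrix.add_mulVec, Matrix.smul_mulVec, Matrix.one_mulVec, Pi.add_apply,
      Pi.smul_apply, smul_eq_mul, Pi.one_apply] at this
    exact this
  -- If `d t` is nonnegative with a zero entry, the left side of that entry's equation is ≤ 0, yet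
  -- it equals 1.
  have hpos_iff : {t | ∀ i, 0 < d t i} = {t | ∀ i, 0 ≤ d t i} := by
    ext t
    refine ⟨fun h i => (h i).le, fun h i => lt_of_le_of_ne (h i) fun h0 => ?_⟩
    have h1 := hrow t i
    have h2 : ∑ j, B j i * d t j ≤ 0 := by
      refine Finset.sum_nonpos fun j _ => ?_
      by_cases hji : j = i
      · rw [hji, ← h0, mul_zero]
      · exact mul_nonpos_of_nonpos_of_nonneg (hoff j i hji) (h j)
    rw [← h0] at h1
    linarith
  have hclopen : IsClopen {t | ∀ i, 0 < d t i} := by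
    constructor
    · rw [hpos_iff, Set.ofPred_forall]
      exact isClosed_iInter fun i =>
        isClosed_le continuous_const ((continuous_apply i).comp hd)
    · rw [Set.ofPred_forall]
      exact isOpen_iInter_of_finite fun i =>
        isOpen_lt continuous_const ((continuous_apply i).comp hd)
  -- This t makes every column sum of B + t I nonnegative; the equation at the smallest entry of `d
  -- t` then forces that entry to be positive.
  have hne : {t | ∀ i, 0 < d t i}.Nonempty := by
    refine ⟨∑ j, ‖∑ i, B i j‖₊, fun i => ?_⟩
    generalize ht : (∑ j, ‖∑ i, B i j‖₊) = t
    have htj : ∀ j, 0 ≤ (∑ i, B i j) + t := by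
      intro j
      have h1 : ‖∑ i, B i j‖₊ ≤ t := by
        rw [← ht]
        exact Finset.single_le_sum (f := fun j => ‖∑ i, B i j‖₊) (fun _ _ => zero_le)
          (Finset.mem_univ j)
      have h2 : |∑ i, B i j| ≤ (t : ℝ) := by exact_mod_cast h1
      linarith [neg_abs_le (∑ i, B i j)]
    have : Nonempty (Fin n) := ⟨i⟩
    obtain ⟨m, hm⟩ := Finite.exists_min (d t)
    refine lt_of_lt_of_le ?_ (hm i)
    have h1 : ∑ i, B i m * d t i ≤ ∑ i, B i m * d t m := by
      refine Finset.sum_le_sum fun j _ => ?_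
      by_cases hjm : j = m
      · rw [hjm]
      · exact mul_le_mul_of_nonpos_left (hm j) (hoff j m hjm)
    rw [← Finset.sum_mul] at h1
    have h2 := hrow t m
    have h3 := htj m
    by_contra hcon
    have := mul_nonpos_of_nonneg_of_nonpos h3 (not_lt.1 hcon)
    linarith
  have huniv := hclopen.eq_univ hne
  have h0 : (0 : NNReal) ∈ {t | ∀ i, 0 < d t i} := huniv ▸ Set.mem_univ _
  refine ⟨d 0, h0, fun j => ?_⟩
  have := hrow 0 j
  simpa [mul_comm] using this

/-! ### The weighted ℓ¹ estimate -/

theorem abs_lincomb_le {a b c e f h z y m : ℝ} (ha : 0 ≤ a) (hb : 0 ≤ b) (hc : 0 ≤ c)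
    (he : 0 ≤ e) (hy : |y| ≤ m) :
    |a * f + b * h - c * z - e * y| ≤ a * |f| + b * |h| + c * |z| + e * m := by
  calc |a * f + b * h - c * z - e * y|
      ≤ |a * f| + |b * h| + |c * z| + |e * y| :=
        (abs_sub _ _).trans (add_le_add_left ((abs_sub _ _).trans
          (add_le_add_left (abs_add_le _ _) _)) _)
    _ = a * |f| + b * |h| + c * |z| + e * |y| := by
        rw [abs_mul, abs_mul, abs_mul, abs_mul, abs_of_nonneg ha, abs_of_nonneg hb,
          abs_of_nonneg hc, abs_of_nonneg he]
    _ ≤ _ := by gcongr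

/-- Both components of an increment of `u = f(u) + h(u)` have the same sign. -/
theorem IsIncrementallySectorBounded.mul_sub_nonneg {n : ℕ} {f h : (Fin n → ℝ) → (Fin n → ℝ)}
    (hf : IsIncrementallySectorBounded f) (hfh : ∀ u, f u + h u = u) (u v : Fin n → ℝ)
    (i : Fin n) : 0 ≤ (f u i - f v i) * (h u i - h v i) := by
  obtain ⟨φ, hφ, hsec⟩ := hf
  have hu : f u i + h u i = u i := congrFun (hfh u) i
  have hv : f v i + h v i = v i := congrFun (hfh v) i
  rw [eq_sub_of_add_eq' hu, eq_sub_of_add_eq' hv, hφ, hφ]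
  by_cases huv : v i = u i
  · rw [huv]; simp
  · obtain ⟨h0, h1⟩ := (hsec i).2 (v i) (u i) huv
    have hne : u i - v i ≠ 0 := sub_ne_zero.2 (Ne.symm huv)
    -- The increments of f and h are θ and 1 - θ times that of u.
    obtain ⟨θ, hθ⟩ : ∃ θ, θ = (φ i (u i) - φ i (v i)) / (u i - v i) := ⟨_, rfl⟩
    rw [← hθ] at h0 h1
    have h2 : φ i (u i) - φ i (v i) = θ * (u i - v i) := by
      rw [hθ, div_mul_cancel₀ _ hne]
    have h3 : u i - φ i (u i) - (v i - φ i (v i)) = (1 - θ) * (u i - v i) := by linarith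
    rw [h2, h3]
    have : θ * (u i - v i) * ((1 - θ) * (u i - v i)) = θ * (1 - θ) * (u i - v i) ^ 2 := by ring
    rw [this]
    exact mul_nonneg (mul_nonneg h0 (by linarith)) (sq_nonneg _)

/-- The Euler step of the incremental closed loop contracts a weighted `ℓ¹` norm of `(u, z)`; the
column sums of `diag(d) B` compensate the positive contribution of `z` to the increments of `f`. -/
theorem sum_weighted_abs_euler_le {n : ℕ} {B : Matrix (Fin n) (Fin n) ℝ}
    {d p r s c k α f h z : Fin n → ℝ} {τ q : ℝ} (hoff : ∀ i j, i ≠ j → B i j ≤ 0)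
    (hd : ∀ j, ∑ i, d i * B i j = 1) (hα : ∀ i, 0 < α i) (hαp : ∀ i, α i * p i = d i)
    (hp : ∀ i, 0 < p i) (hr : ∀ i, 0 < r i) (hc : ∀ i, 0 < c i) (hk : ∀ i, 0 < k i)
    (hps : ∀ i, p i * s i < 1) (hτ : 0 < τ)
    (hτf : ∀ i, 0 ≤ 1 - τ * (c i / p i + p i * B i i))
    (hτh : ∀ i, 0 ≤ 1 - τ * (c i / p i + r i * s i))
    (hτz : ∀ i, 0 ≤ 1 - τ * (r i / p i))
    (hqf : ∀ i, α i - τ * (1 - α i * (k i - c i) / p i) ≤ q * α i)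
    (hqh : ∀ i, 1 - τ * (c i / p i + r i * s i - k i * (1 / p i - s i)) ≤ q)
    (hqz : ∀ i, k i - τ * (r i * (k i - c i) / p i) ≤ q * k i)
    (hfh : ∀ i, 0 ≤ f i * h i) :
    ∑ i, |α i * ((f i + h i) + τ * (-(c i / p i) * (f i + h i + r i * z i)
        - p i * (∑ j, B i j * f j) - r i * s i * h i))|
      + ∑ i, |α i * k i * (z i + τ * (-(r i / p i) * z i - f i / p i - (1 / p i - s i) * h i))|
      ≤ q * (∑ i, |α i * (f i + h i)| + ∑ i, |α i * k i * z i|) := by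
  have hW : ∑ i, d i * (∑ j, B i j * |f j|) = ∑ j, |f j| := by
    simp_rw [Finset.mul_sum]
    rw [Finset.sum_comm]
    refine Finset.sum_congr rfl fun j _ => ?_
    simp_rw [← mul_assoc]
    rw [← Finset.sum_mul, hd, one_mul]
  have hoffsum : ∀ i, |∑ j ∈ Finset.univ.erase i, B i j * f j| ≤
      -∑ j ∈ Finset.univ.erase i, B i j * |f j| := by
    intro i
    rw [← Finset.sum_neg_distrib]
    refine (Finset.abs_sum_le_sum_abs _ _).trans (Finset.sum_le_sum fun j hj => ?_)
    rw [abs_mul, abs_of_nonpos (hoff i j (Finset.ne_of_mem_erase hj).symm), neg_mul]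
  have hrowu : ∀ i, |α i * ((f i + h i) + τ * (-(c i / p i) * (f i + h i + r i * z i)
        - p i * (∑ j, B i j * f j) - r i * s i * h i))| ≤
      α i * ((1 - τ * (c i / p i)) * |f i| + (1 - τ * (c i / p i + r i * s i)) * |h i|
        + τ * (c i / p i * r i) * |z i|) - τ * (d i * ∑ j, B i j * |f j|) := by
    intro i
    have := hα i; have := hp i; have := hr i; have := hc i
    -- The diagonal entry of B joins the coefficient of `f i`; the off-diagonal sum plays the role
    -- of y.
    have h1 := abs_lincomb_le (f := f i) (h := h i) (z := z i) (hτf i) (hτh i)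
      (c := τ * (c i / p i * r i)) (e := τ * p i) (by positivity) (by positivity) (hoffsum i)
    rw [abs_mul, abs_of_pos (hα i), ← hαp,
      ← Finset.add_sum_erase _ (fun j => B i j * f j) (Finset.mem_univ i),
      ← Finset.add_sum_erase _ (fun j => B i j * |f j|) (Finset.mem_univ i)]
    refine (mul_le_mul_of_nonneg_left (le_of_eq_of_le (congrArg abs ?_) h1)
      (hα i).le).trans (le_of_eq ?_)
    · ring
    · ring
  have hrowz : ∀ i, |α i * k i * (z i + τ * (-(r i / p i) * z i - f i / p i
        - (1 / p i - s i) * h i))| ≤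
      α i * k i * ((1 - τ * (r i / p i)) * |z i| + τ / p i * |f i|
        + τ * (1 / p i - s i) * |h i|) := by
    intro i
    have := hα i; have := hp i; have := hk i
    have hps' : 0 ≤ 1 / p i - s i := by
      rw [sub_nonneg, le_div_iff₀ (hp i), mul_comm]; exact (hps i).le
    have h1 := abs_lincomb_le (f := z i) (h := 0) (z := f i) (y := h i) (hτz i) le_rfl
      (c := τ / p i) (e := τ * (1 / p i - s i)) (by positivity) (by positivity) le_rfl
    rw [abs_mul, abs_of_pos (by positivity : 0 < α i * k i)]
    refine (mul_le_mul_of_nonneg_left (le_of_eq_of_le (congrArg abs ?_) h1)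
      (by positivity)).trans (le_of_eq ?_)
    · ring
    · ring
  calc _ ≤ ∑ i, (α i * ((1 - τ * (c i / p i)) * |f i| + (1 - τ * (c i / p i + r i * s i)) * |h i|
          + τ * (c i / p i * r i) * |z i|) - τ * (d i * ∑ j, B i j * |f j|))
        + ∑ i, α i * k i * ((1 - τ * (r i / p i)) * |z i| + τ / p i * |f i|
          + τ * (1 / p i - s i) * |h i|) :=
        add_le_add (Finset.sum_le_sum fun i _ => hrowu i) (Finset.sum_le_sum fun i _ => hrowz i)
    _ = ∑ i, (α i * ((1 - τ * (c i / p i)) * |f i| + (1 - τ * (c i / p i + r i * s i)) * |h i|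
          + τ * (c i / p i * r i) * |z i|) + α i * k i * ((1 - τ * (r i / p i)) * |z i|
          + τ / p i * |f i| + τ * (1 / p i - s i) * |h i|) - τ * |f i|) := by
        rw [Finset.sum_sub_distrib, ← Finset.mul_sum, hW, Finset.sum_sub_distrib,
          Finset.sum_add_distrib, ← Finset.mul_sum]
        ring
    _ ≤ ∑ i, q * (|α i * (f i + h i)| + |α i * k i * z i|) := by
        refine Finset.sum_le_sum fun i _ => ?_
        -- Equal signs exclude cancellation; this is where the sector condition enters.
        have hab : |f i + h i| = |f i| + |h i| := by
          rw [abs_add_eq_add_abs_iff]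
          exact mul_nonneg_iff.1 (hfh i)
        have hαk := mul_pos (hα i) (hk i)
        rw [abs_mul, abs_mul (α i * k i), abs_of_pos (hα i), abs_of_pos hαk, hab]
        have h1 := mul_le_mul_of_nonneg_right (hqf i) (abs_nonneg (f i))
        have h2 := mul_le_mul_of_nonneg_right
          (mul_le_mul_of_nonneg_left (hqh i) (hα i).le) (abs_nonneg (h i))
        have h3 := mul_le_mul_of_nonneg_right
          (mul_le_mul_of_nonneg_left (hqz i) (hα i).le) (abs_nonneg (z i))
        refine le_trans (le_of_eq ?_) ((add_le_add (add_le_add h1 h2) h3).trans (le_of_eq ?_))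
        · ring
        · ring
    _ = _ := by rw [← Finset.mul_sum, Finset.sum_add_distrib]

/-! ### Coordinates and choice of constants -/

/-- The weighted coordinates `(a u, b z)` of the state `(x, z)`, with the `ℓ¹` norm. -/
noncomputable def weightedCoordinates {n : ℕ} (p r a b : Fin n → ℝ) (hp : ∀ i, 0 < p i)
    (ha : ∀ i, 0 < a i) (hb : ∀ i, 0 < b i) :
    ((Fin n → ℝ) × (Fin n → ℝ)) ≃L[ℝ] PiLp 1 fun _ : Fin n ⊕ Fin n => ℝ :=
  LinearEquiv.toContinuousLinearEquiv
    { toFun := fun ξ => WithLp.toLp 1 (Sum.elim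
        (fun i => a i * controllerOutput p r ξ.1 ξ.2 i) (fun i => b i * ξ.2 i))
      invFun := fun y =>
        (fun i => -(y (Sum.inl i) / a i + r i * (y (Sum.inr i) / b i)) / p i,
          fun i => y (Sum.inr i) / b i)
      map_add' := fun ξ η => by
        ext (i | i) <;> simp [controllerOutput] <;> ring
      map_smul' := fun t ξ => by
        ext (i | i) <;> simp [controllerOutput] <;> ring
      left_inv := fun ξ => by
        ext i
        · have := (hp i).ne'; have := (ha i).ne'; have := (hb i).ne'
          simp only [controllerOutput, Sum.elim_inl, Sum.elim_inr]
          field_simp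
          ring
        · have := (hb i).ne'
          simp only [Sum.elim_inr]
          field_simp
      right_inv := fun y => by
        ext (i | i)
        · have := (hp i).ne'; have := (ha i).ne'; have := (hb i).ne'
          simp only [controllerOutput, Sum.elim_inl]
          field_simp
          ring
        · have := (hb i).ne'
          simp only [Sum.elim_inr]
          field_simp }

theorem norm_weightedCoordinates {n : ℕ} (p r a b : Fin n → ℝ) (hp : ∀ i, 0 < p i)
    (ha : ∀ i, 0 < a i) (hb : ∀ i, 0 < b i) (ξ : (Fin n → ℝ) × (Fin n → ℝ)) :
    ‖weightedCoordinates p r a b hp ha hb ξ‖ =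
      ∑ i, |a i * controllerOutput p r ξ.1 ξ.2 i| + ∑ i, |b i * ξ.2 i| := by
  rw [PiLp.norm_eq_of_L1, Fintype.sum_sum_type]
  rfl

theorem eventually_mul_lt (a : ℝ) {b : ℝ} (hb : 0 < b) : ∀ᶠ x in 𝓝[>] (0 : ℝ), a * x < b := by
  have h : Tendsto (fun x : ℝ => a * x) (𝓝[>] 0) (𝓝 (a * 0)) :=
    (by fun_prop : Continuous fun x : ℝ => a * x).continuousAt.mono_left nhdsWithin_le_nhds
  rw [mul_zero] at h
  exact h.eventually (eventually_lt_nhds hb)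

theorem theorem2 (n : ℕ) (A B : Matrix (Fin n) (Fin n) ℝ)
    (f h : (Fin n → ℝ) → (Fin n → ℝ)) (p r s w : Fin n → ℝ)
    (hf : IsIncrementallySectorBounded f) (hfh : ∀ u, f u + h u = u)
    (hA_diag : A.IsDiag) (hA_pos : A.PosDef) (hB : IsMMatrix B)
    (hp : ∀ i, 0 < p i) (hr : ∀ i, 0 < r i) (hs : ∀ i, 0 < s i)
    (hpr : ∀ i, A i i * p i > r i) (hps : ∀ i, p i * s i < 1) :
    ∃ e : (Fin n → ℝ) × (Fin n → ℝ),
      (∀ e', IsEquilibrium (closedLoop A B f h p r s w) e' → e' = e) ∧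
      IsGloballyAsymptoticallyStable (closedLoop A B f h p r s w) e := by
  obtain ⟨d, hd, hdB⟩ := hB.exists_pos_vecMul_eq_one
  let c : Fin n → ℝ := fun i => A i i * p i - r i
  have hc : ∀ i, 0 < c i := fun i => sub_pos.2 (hpr i)
  let α : Fin n → ℝ := fun i => d i / p i
  have hα : ∀ i, 0 < α i := fun i => div_pos (hd i) (hp i)
  have hαp : ∀ i, α i * p i = d i := fun i => div_mul_cancel₀ _ (hp i).ne'
  -- ε = k - c: positive to give decay in z, small to keep the decay in f and h.
  obtain ⟨ε, hε, hε0⟩ : ∃ ε : ℝ, (∀ i, α i / p i * ε < 1 ∧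
      (1 / p i - s i) * ε < r i * s i + c i * s i) ∧ 0 < ε := by
    refine ((eventually_all.2 fun i => ?_).and self_mem_nhdsWithin).exists (f := 𝓝[>] (0 : ℝ))
    have := hr i; have := hs i; have := hc i
    exact (eventually_mul_lt _ one_pos).and (eventually_mul_lt _ (by positivity))
  let k : Fin n → ℝ := fun i => c i + ε
  have hk : ∀ i, 0 < k i := fun i => add_pos (hc i) hε0
  -- l is a common decay rate below the three margins left by ε.
  obtain ⟨l, hl, hl0⟩ : ∃ l : ℝ, (∀ i, α i * l < 1 - α i / p i * ε ∧
      1 * l < r i * s i + c i * s i - (1 / p i - s i) * ε ∧ k i * l < r i * ε / p i) ∧ 0 < l := by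
    refine ((eventually_all.2 fun i => ?_).and self_mem_nhdsWithin).exists (f := 𝓝[>] (0 : ℝ))
    have := hr i; have := hp i
    exact (eventually_mul_lt _ (sub_pos.2 (hε i).1)).and
      ((eventually_mul_lt _ (sub_pos.2 (hε i).2)).and (eventually_mul_lt _ (by positivity)))
  -- Small τ keeps the diagonal Euler coefficients nonnegative and q = 1 - lτ in (0, 1).
  obtain ⟨τ, ⟨hτ, hlτ⟩, hτ0⟩ : ∃ τ : ℝ, ((∀ i, (c i / p i + p i * B i i) * τ < 1 ∧
      (c i / p i + r i * s i) * τ < 1 ∧ r i / p i * τ < 1) ∧ l * τ < 1) ∧ 0 < τ :=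
    (((eventually_all.2 fun i => (eventually_mul_lt _ one_pos).and ((eventually_mul_lt _
      one_pos).and (eventually_mul_lt _ one_pos))).and (eventually_mul_lt _ one_pos)).and
      self_mem_nhdsWithin).exists (f := 𝓝[>] (0 : ℝ))
  let T := weightedCoordinates p r α (fun i => α i * k i) hp hα fun i => mul_pos (hα i) (hk i)
  let F := closedLoop A B f h p r s w
  have hcontr : ∀ ξ η, ‖T ((ξ + τ • F ξ) - (η + τ • F η))‖ ≤ (1 - l * τ) * ‖T (ξ - η)‖ := by
    intro ξ η
    obtain ⟨u, hu⟩ : ∃ u, u = controllerOutput p r ξ.1 ξ.2 := ⟨_, rfl⟩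
    obtain ⟨v, hv⟩ : ∃ v, v = controllerOutput p r η.1 η.2 := ⟨_, rfl⟩
    have hui : ∀ i, f u i + h u i = -(p i) * ξ.1 i - r i * ξ.2 i := fun i => by
      rw [← Pi.add_apply, hfh, hu]; rfl
    have hvi : ∀ i, f v i + h v i = -(p i) * η.1 i - r i * η.2 i := fun i => by
      rw [← Pi.add_apply, hfh, hv]; rfl
    have hAx : ∀ (x : Fin n → ℝ) i, A.mulVec x i = A i i * x i := by
      intro x i
      rw [Matrix.mulVec, dotProduct]
      exact Finset.sum_eq_single i (fun j _ hj => by rw [hA_diag hj.symm, zero_mul]) (by simp)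
    have hmain := sum_weighted_abs_euler_le (q := 1 - l * τ) (f := fun i => f u i - f v i)
      (h := fun i => h u i - h v i) (z := fun i => ξ.2 i - η.2 i) (s := s) hB.2 hdB hα hαp hp hr hc
      hk hps hτ0 (fun i => by linarith [(hτ i).1]) (fun i => by linarith [(hτ i).2.1])
      (fun i => by linarith [(hτ i).2.2])
      (fun i => by
        have := mul_le_mul_of_nonneg_left (hl i).1.le hτ0.le
        have h2 : α i * (k i - c i) / p i = α i / p i * ε := by simp only [k]; ring
        rw [h2]
        linarith)
      (fun i => by
        have := mul_le_mul_of_nonneg_left (hl i).2.1.le hτ0.le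
        have h2 : c i / p i = c i * (1 / p i) := by ring
        simp only [k, h2]
        linarith)
      (fun i => by
        have := mul_le_mul_of_nonneg_left (hl i).2.2.le hτ0.le
        have h2 : k i - c i = ε := add_sub_cancel_left _ _
        rw [h2]
        linarith)
      (fun i => hf.mul_sub_nonneg hfh u v i)
    rw [norm_weightedCoordinates, norm_weightedCoordinates]
    refine le_of_eq_of_le ?_ (hmain.trans_eq ?_)
    · congr 1
      · refine Finset.sum_congr rfl fun i _ => ?_
        have hx : ξ.1 i - η.1 i = -((f u i - f v i) + (h u i - h v i)
            + r i * (ξ.2 i - η.2 i)) / p i := by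
          rw [eq_div_iff (hp i).ne']
          linarith [hui i, hvi i]
        have hsum : ∑ j, B i j * (f u j - f v j) = B.mulVec (f u) i - B.mulVec (f v) i := by
          simp only [mul_sub, Finset.sum_sub_distrib]; rfl
        congr 2
        simp only [controllerOutput, F, closedLoop, ← hu, ← hv, Prod.fst_sub, Prod.snd_sub,
          Prod.fst_add, Prod.snd_add, Prod.smul_fst, Prod.smul_snd, Pi.sub_apply, Pi.add_apply,
          Pi.smul_apply, Pi.neg_apply, smul_eq_mul, hAx, hsum]
        have hcx : -(c i / p i) * ((f u i - f v i) + (h u i - h v i) + r i * (ξ.2 i - η.2 i)) =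
            c i * (ξ.1 i - η.1 i) := by rw [hx]; ring
        rw [hcx]
        simp only [c]
        linear_combination -(hui i) + hvi i
      · refine Finset.sum_congr rfl fun i _ => ?_
        have hx : ξ.1 i - η.1 i = -((f u i - f v i) + (h u i - h v i)
            + r i * (ξ.2 i - η.2 i)) / p i := by
          rw [eq_div_iff (hp i).ne']
          linarith [hui i, hvi i]
        congr 2
        simp only [F, closedLoop, ← hu, ← hv, Prod.snd_sub, Prod.snd_add, Prod.smul_snd,
          Pi.sub_apply, Pi.add_apply, Pi.smul_apply, smul_eq_mul]
        linear_combination τ * hx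
    · congr 2
      refine Finset.sum_congr rfl fun i _ => ?_
      congr 2
      simp only [controllerOutput, Prod.fst_sub, Prod.snd_sub, Pi.sub_apply]
      linear_combination hui i - hvi i
  obtain ⟨e, huniq, he⟩ := exists_isGloballyAsymptoticallyStable_of_euler_contraction
    (F := fun y => T (F (T.symm y))) hτ0 (q := 1 - l * τ) (by linarith)
    (by linarith [mul_pos hl0 hτ0]) fun x y => by
      simpa only [map_sub, map_add, map_smul, T.apply_symm_apply] using
        hcontr (T.symm x) (T.symm y)
  refine ⟨T.symm e, fun e' he' => T.eq_symm_apply.2 (huniq _ ?_), he.of_conj T⟩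
  have h1 : F e' = 0 := he'
  simp only [IsEquilibrium, T.symm_apply_apply, h1, map_zero]
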